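/- Let $\mathcal X$ be a measurable space, $\mathcal Y=\{1,\dots,n\}$, let $\mathcal D$ be any probability distribution on $\mathcal X\times\mathcal Y$, and let $\mathcal H\subseteq\mathcal Y^{\mathcal X}$ be a hypothesis class of measurable classifiers. For $h\in\mathcal H$ and a sample $S=((x_1,y_1),\dots,(x_m,y_m))$ put $$R_{\mathcal D}(h)=\mathbb E_{(x,y)\sim\mathcal D}\,\mathbf 1[h(x)\ne y],\qquad R_S(h)=\frac1m\sum_{i=1}^m\mathbf 1[h(x_i)\ne y_i],$$ and let $\tau_{\mathcal H}(N)=\max_{x_1,\dots,x_N\in\mathcal X}\bigl|\{(h(x_1),\dots,h(x_N)):h\in\mathcal H\}\bigr|$ be the growth function. Let $$\mathrm{Hyp}(k,m,K,M)=\sum_{j=0}^{k}\binom Kj\binom{M-K}{m-j}\Big/\binom Mm$$ be the hypergeometric tail, and, for $0\le k<m\le M$ and $p\in(0,1)$, let $$\underline{\mathrm{Hyp}}(k,m,p,M)=\max\{K\in\{0,\dots,M\}:\mathrm{Hyp}(k,m,K,M)\ge p\}$$ be its lower pseudo-inverse. Let $\delta\in(0,1)$ and let $m,m'>0$ be integers.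 Assume the usual measurability of $\mathcal H$: the restriction $\mathcal H|_T=\{(h(x_1),\dots,h(x_{m+m'})):h\in\mathcal H\}$ is a measurable function, up to $\mathcal D^{m+m'}$-null sets, of the sample $T=((x_1,y_1),\dots,(x_{m+m'},y_{m+m'}))$ (this is automatic for countable $\mathcal H$). Then $$\Pr_{S\sim\mathcal D^m}\bigl(\forall h\in\mathcal H:\ R_{\mathcal D}(h)\ge\epsilon(mR_S(h))\bigr)>1-\delta,$$ where $\epsilon(0)=0$ and, for $1\le k\le m$, $$\epsilon(k)=\frac1{m'}\min\Bigl\{m'-1,\ \underline{\mathrm{Hyp}}\Bigl(k-1,\,m,\,1-\frac{\delta}{4\tau_{\mathcal H}(m+m')},\,m+m'\Bigr)+1-k\Bigr\}.$$ The complementary event (some $h\in\mathcal H$ violates the bound) has outer probability less than $\delta$, whether or not it is measurable. -/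

import Mathlib

open MeasureTheory

noncomputable section

namespace HypTail

/-- Probability of drawing exactly `k` successes in a sample of `m` elements, without replacement,
from a population of `M` elements that contains `K` successes. A binomial coefficient with negative
lower entry `m - k` is `0`. -/
def hyp (k m K M : ℕ) : ℝ :=
  if k ≤ m then ((K.choose k : ℝ) * ((M - K).choose (m - k) : ℝ)) / (M.choose m : ℝ) else 0

/-- The hypergeometric tail (cumulative distribution) function. -/
def Hyp (k m K M : ℕ) : ℝ :=
  ∑ j ∈ Finset.range (k + 1), hyp j m K M

/-- The lower pseudo-inverse of the hypergeometric tail: the largest number `K` of successes in the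
population (so `K ≤ M`) whose tail is at least `p`. -/
def lowerInv (k m : ℕ) (p : ℝ) (M : ℕ) : ℕ :=
  sSup {K : ℕ | K ≤ M ∧ p ≤ Hyp k m K M}

/-- For `m ≤ M` and `p ≤ 1`, the maximum that defines `lowerInv` is attained. -/
theorem lowerInv_isGreatest {k m M : ℕ} {p : ℝ} (hmM : m ≤ M) (hp : p ≤ 1) :
    IsGreatest {K : ℕ | K ≤ M ∧ p ≤ Hyp k m K M} (lowerInv k m p M) := by
  have hne : {K : ℕ | K ≤ M ∧ p ≤ Hyp k m K M}.Nonempty := by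
    refine ⟨0, Nat.zero_le _, ?_⟩
    have hM : (M.choose m : ℝ) ≠ 0 := by
      exact_mod_cast (Nat.choose_pos hmM).ne'
    have h1 : Hyp k m 0 M = 1 := by
      unfold Hyp
      rw [Finset.sum_range_succ']
      simp [hyp, hM]
    rw [h1]
    exact hp
  have hb : BddAbove {K : ℕ | K ≤ M ∧ p ≤ Hyp k m K M} := ⟨M, fun K hK => hK.1⟩
  exact ⟨Nat.sSup_mem hne hb, fun K hK => le_csSup hb hK⟩

section Learning

variable {X : Type*} {n : ℕ}

/-- The restrictions `(h (x 0), …, h (x (N - 1)))` of the classifiers `h ∈ H` to the points `x`. -/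
def traces (H : Set (X → Fin n)) {N : ℕ} (x : Fin N → X) : Set (Fin N → Fin n) :=
  {c | ∃ h ∈ H, ∀ i, h (x i) = c i}

/-- The growth function of `H`: the largest number of restrictions to `N` points. -/
def growth (H : Set (X → Fin n)) (N : ℕ) : ℕ :=
  ⨆ x : Fin N → X, (traces H x).ncard

/-- The numbers in the supremum that defines `growth` are bounded, so it is a maximum. -/
theorem growth_bddAbove (H : Set (X → Fin n)) (N : ℕ) :
    BddAbove (Set.range fun x : Fin N → X => (traces H x).ncard) := by
  refine ⟨(Set.univ : Set (Fin N → Fin n)).ncard, ?_⟩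
  rintro _ ⟨x, rfl⟩
  exact Set.ncard_le_ncard (Set.subset_univ _) Set.finite_univ

/-- The true risk: the expected zero-one loss of `h` under `D`. -/
def trueRisk [MeasurableSpace X] (D : Measure (X × Fin n)) (h : X → Fin n) : ℝ :=
  ∫ z, (if h z.1 ≠ z.2 then (1 : ℝ) else 0) ∂D

/-- The empirical risk: the average zero-one loss of `h` on the sample `S`. -/
def empRisk {m : ℕ} (S : Fin m → X × Fin n) (h : X → Fin n) : ℝ :=
  (1 / (m : ℝ)) * ∑ i, if h (S i).1 ≠ (S i).2 then (1 : ℝ) else 0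

/-- The number of errors of `h` on the sample `S`, that is, `m` times the empirical risk. -/
def numErrors {m : ℕ} (S : Fin m → X × Fin n) (h : X → Fin n) : ℕ :=
  (Finset.univ.filter fun i => h (S i).1 ≠ (S i).2).card

theorem mul_empRisk {m : ℕ} (hm : 0 < m) (S : Fin m → X × Fin n) (h : X → Fin n) :
    (m : ℝ) * empRisk S h = (numErrors S h : ℝ) := by
  have hm' : (m : ℝ) ≠ 0 := by exact_mod_cast hm.ne'
  unfold empRisk numErrors
  rw [Finset.card_filter]
  push_cast
  field_simp

/-- The bound `ε`, as a function of the number `k` of errors. The last difference is taken in `ℝ`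
(it may be negative). -/
def lowerBound (H : Set (X → Fin n)) (m m' : ℕ) (δ : ℝ) (k : ℕ) : ℝ :=
  if k = 0 then 0
  else (1 / (m' : ℝ)) * min ((m' : ℝ) - 1)
    ((lowerInv (k - 1) m (1 - δ / (4 * (growth H (m + m') : ℝ))) (m + m') : ℝ) + 1 - (k : ℝ))

/-- Measurability of a hypothesis class along i.i.d. samples of size `N` from `D`: every classifier
is measurable, and so (up to null sets) is the map `T ↦ H|_T` from the samples of size `N` to the
finite set of all sets of label vectors. All countable classes of measurable classifiers satisfy
this. -/
structure IsMeasurableClass [MeasurableSpace X] (D : Measure (X × Fin n))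
    (H : Set (X → Fin n)) (N : ℕ) : Prop where
  measurable : ∀ h ∈ H, Measurable h
  nullMeasurableSet_traces : ∀ c : Fin N → Fin n,
    NullMeasurableSet {T : Fin N → X × Fin n | c ∈ traces H fun i => (T i).1}
      (Measure.pi fun _ : Fin N => D)

end Learning

end HypTail

end

/-! The proof is a ghost-sample argument. Suppose `h` makes `k` errors on `S` and violates the
bound. The cap `m' - 1` forces `h` to be correct with probability `q > 1 / m'`, so on a fresh sample
of size `m'` it is correct at least `m' q` times with probability greater than `1 / 4`
(`quarter_lt_pi_real_mean_le`). Then the joint sample contains so few errors that its error set is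
no larger than the pseudo-inverse at `k - 1`; this is the event `deviationSet`.

That event has probability at most `δ / 4`. The joint sample is exchangeable, so the first `m`
positions may be replaced by a uniformly random `m`-subset. For fixed labels the random subset
deviates with probability at most `η = δ / (4 τ)`, where `τ` is the growth function
(`card_filter_card_le_lowerInv_le`), and a union bound over at most `τ` restrictions gives `τ η ≤ δ
/ 4`. Comparing the two estimates by a strict Markov inequality (`measureReal_lt_of_lt_section`)
gives outer probability below `δ`. -/

noncomputable section

namespace HypTail

/-! ### Binomial tails at the mean. -/

section BinomialTail

open Polynomial

/-- The cumulative distribution function of the binomial distribution, as a polynomial in the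
success probability. -/
def binomialCdf (n k : ℕ) : ℝ[X] :=
  ∑ j ∈ Finset.range (k + 1), bernsteinPolynomial ℝ n j

theorem bernsteinPolynomial_succ_succ (n k : ℕ) :
    bernsteinPolynomial ℝ (n + 1) (k + 1) =
      X * bernsteinPolynomial ℝ n k + (1 - X) * bernsteinPolynomial ℝ n (k + 1) := by
  unfold bernsteinPolynomial
  rw [Nat.choose_succ_succ, Nat.add_sub_add_right]
  rcases lt_or_ge n (k + 1) with h | h
  · rw [Nat.choose_eq_zero_of_lt h]
    push_cast
    ring
  · obtain ⟨d, rfl⟩ := Nat.exists_eq_add_of_le h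
    rw [show k + 1 + d - k = d + 1 by omega, show k + 1 + d - (k + 1) = d by omega]
    push_cast
    ring

/-- One more trial pushes the count above `k` exactly when the count was `k` and the new trial
succeeds. -/
theorem binomialCdf_succ_left (n k : ℕ) :
    binomialCdf (n + 1) k = binomialCdf n k - X * bernsteinPolynomial ℝ n k := by
  induction k with
  | zero =>
    simp [binomialCdf, bernsteinPolynomial]
    ring
  | succ k ih =>
    have h : ∀ n, binomialCdf n (k + 1) =
        binomialCdf n k + bernsteinPolynomial ℝ n (k + 1) :=
      fun n => Finset.sum_range_succ _ _
    rw [h, h, ih, bernsteinPolynomial_succ_succ]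
    ring

theorem derivative_binomialCdf (n k : ℕ) :
    derivative (binomialCdf n k) = -((n : ℝ[X]) * bernsteinPolynomial ℝ (n - 1) k) := by
  induction k with
  | zero => simp [binomialCdf, bernsteinPolynomial.derivative_zero]
  | succ k ih =>
    have h : binomialCdf n (k + 1) = binomialCdf n k + bernsteinPolynomial ℝ n (k + 1) :=
      Finset.sum_range_succ _ _
    rw [h, derivative_add, ih, bernsteinPolynomial.derivative_succ]
    ring

theorem bernsteinPolynomial_eval_pos {n k : ℕ} (hk : k ≤ n) {a : ℝ} (h0 : 0 < a) (h1 : a < 1) :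
    0 < (bernsteinPolynomial ℝ n k).eval a := by
  have : 0 < n.choose k := Nat.choose_pos hk
  have : 0 < 1 - a := by linarith
  simp only [bernsteinPolynomial, eval_mul, eval_natCast, eval_pow, eval_X, eval_sub, eval_one]
  positivity

theorem binomialCdf_strictAntiOn {n k : ℕ} (hk : k < n) :
    StrictAntiOn (fun a => (binomialCdf n k).eval a) (Set.Icc (0 : ℝ) 1) := by
  apply strictAntiOn_of_deriv_neg (convex_Icc _ _) (binomialCdf n k).continuous.continuousOn
  intro a ha
  rw [interior_Icc] at ha
  rw [Polynomial.deriv, derivative_binomialCdf]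
  have hb := bernsteinPolynomial_eval_pos (show k ≤ n - 1 by omega) ha.1 ha.2
  have hn : (0 : ℝ) < n := by exact_mod_cast (by omega : 0 < n)
  simp only [eval_neg, eval_mul, eval_natCast]
  nlinarith [mul_pos hn hb]

/-- After clearing denominators, the ratio of consecutive weights is at most `1` when `(n - k) a ≤
(k + 1) (1 - a)`, which rearranges to `h`. -/
theorem bernsteinPolynomial_eval_succ_le {n k : ℕ} {a : ℝ} (h0 : 0 ≤ a) (h1 : a ≤ 1)
    (h : (n + 1) * a ≤ k + 1) :
    (bernsteinPolynomial ℝ n (k + 1)).eval a ≤ (bernsteinPolynomial ℝ n k).eval a := by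
  have h1' : 0 ≤ 1 - a := by linarith
  simp only [bernsteinPolynomial, eval_mul, eval_natCast, eval_pow, eval_X, eval_sub, eval_one]
  rcases lt_or_ge n (k + 1) with hn | hn
  · rw [Nat.choose_eq_zero_of_lt hn]
    simp only [Nat.cast_zero, zero_mul]
    positivity
  · obtain ⟨d, rfl⟩ := Nat.exists_eq_add_of_le hn
    have hc : (((k + 1 + d).choose (k + 1) : ℕ) : ℝ) * (k + 1) =
        ((k + 1 + d).choose k : ℕ) * (d + 1) := by
      have := Nat.choose_succ_right_eq (k + 1 + d) k
      rw [show k + 1 + d - k = d + 1 by omega] at this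
      exact_mod_cast this
    rw [show k + 1 + d - k = d + 1 by omega, show k + 1 + d - (k + 1) = d by omega]
    push_cast at h
    have hk : (0 : ℝ) < k + 1 := by positivity
    refine le_of_mul_le_mul_left ?_ hk
    have hpos : 0 ≤ (((k + 1 + d).choose k : ℕ) : ℝ) * a ^ k * (1 - a) ^ d := by positivity
    calc (k + 1 : ℝ) * (((k + 1 + d).choose (k + 1) : ℕ) * a ^ (k + 1) * (1 - a) ^ d)
        = (((k + 1 + d).choose (k + 1) : ℕ) * (k + 1)) * a ^ (k + 1) * (1 - a) ^ d := by ring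
      _ = (((k + 1 + d).choose k : ℕ) * a ^ k * (1 - a) ^ d) * ((d + 1) * a) := by
        rw [hc]; ring
      _ ≤ (((k + 1 + d).choose k : ℕ) * a ^ k * (1 - a) ^ d) * ((k + 1) * (1 - a)) := by
        gcongr 1
        linarith
      _ = _ := by ring

/-- At fixed integral mean `k`, the probability that a binomial random variable is at most its mean
decreases with the number of trials. -/
theorem binomialCdf_mean_succ_le {n k : ℕ} (hk : 0 < k) (hkn : k ≤ n) :
    (binomialCdf (n + 1) k).eval ((k : ℝ) / (n + 1)) ≤ (binomialCdf n k).eval ((k : ℝ) / n) := by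
  obtain ⟨k, rfl⟩ := Nat.exists_eq_succ_of_ne_zero hk.ne'
  obtain ⟨n, rfl⟩ := Nat.exists_eq_succ_of_ne_zero (by omega : n ≠ 0)
  simp only [Nat.succ_eq_add_one] at *
  -- `G` joins the two sides: at `(k + 1) / (n + 1)` the correction vanishes, and at `a = (k + 1) /
  -- (n + 2)` its factor equals `a`, so `binomialCdf_succ_left` turns `G` into the tail with one
  -- more trial. Between these points both nonconstant factors of the derivative are nonnegative.
  set G : ℝ[X] := binomialCdf (n + 1) (k + 1) -
    (((k + 1 : ℕ) : ℝ[X]) - ((n + 1 : ℕ) : ℝ[X]) * X) * bernsteinPolynomial ℝ (n + 1) (k + 1)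
    with hG
  have hn : (0 : ℝ) < n + 1 := by positivity
  have hkn' : (k + 1 : ℝ) ≤ n + 1 := by exact_mod_cast hkn
  have hle : (k + 1 : ℝ) / (n + 1 + 1) ≤ (k + 1) / (n + 1) := by gcongr; linarith
  have hmono : MonotoneOn (fun a => G.eval a)
      (Set.Icc ((k + 1 : ℝ) / (n + 1 + 1)) ((k + 1) / (n + 1))) := by
    apply monotoneOn_of_deriv_nonneg (convex_Icc _ _) G.continuous.continuousOn
      G.differentiable.differentiableOn
    intro a ha
    rw [interior_Icc] at ha
    have ha1 : k + 1 < a * (n + 1 + 1) := (div_lt_iff₀ (by positivity)).1 ha.1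
    have ha2 : a * (n + 1) < k + 1 := (lt_div_iff₀ (by positivity)).1 ha.2
    have ha0 : 0 < a := lt_trans (by positivity) ha.1
    have ha3 : a < 1 := lt_of_lt_of_le ha.2 ((div_le_one hn).2 hkn')
    have hb := bernsteinPolynomial_eval_succ_le (n := n) (k := k) ha0.le ha3.le (by linarith)
    have hd : derivative G = ((n + 1 : ℕ) : ℝ[X]) *
        (X - (((k + 1 : ℕ) : ℝ[X]) - ((n + 1 : ℕ) : ℝ[X]) * X)) *
        (bernsteinPolynomial ℝ n k - bernsteinPolynomial ℝ n (k + 1)) := by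
      rw [hG, derivative_sub, derivative_mul, derivative_binomialCdf,
        bernsteinPolynomial.derivative_succ, Nat.add_sub_cancel, bernsteinPolynomial_succ_succ]
      simp only [derivative_sub, derivative_mul, derivative_natCast, derivative_X]
      ring
    rw [Polynomial.deriv, hd]
    simp only [eval_mul, eval_sub, eval_natCast, eval_X]
    push_cast
    apply mul_nonneg (mul_nonneg hn.le _) _ <;> linarith
  have := hmono (Set.left_mem_Icc.2 hle) (Set.right_mem_Icc.2 hle) hle
  simp only [hG, eval_mul, eval_sub, eval_natCast, eval_X] at this
  rw [binomialCdf_succ_left]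
  simp only [eval_mul, eval_sub, eval_X]
  push_cast at this ⊢
  rw [mul_div_cancel₀ _ hn.ne'] at this
  have e : (k + 1 : ℝ) - (n + 1) * ((k + 1) / (n + 1 + 1)) = (k + 1) / (n + 1 + 1) := by
    field_simp
    ring
  rw [e] at this
  linarith

/-- Bernoulli's inequality with the real exponent `n / 2 ≥ 1` gives `1 / 2`, which is then squared.
-/
theorem quarter_le_one_sub_inv_pow {n : ℕ} (hn : 2 ≤ n) : (1 / 4 : ℝ) ≤ (1 - 1 / n) ^ n := by
  have hn' : (2 : ℝ) ≤ n := by exact_mod_cast hn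
  have h0 : (0 : ℝ) ≤ 1 - 1 / n := by
    rw [sub_nonneg, div_le_one (by linarith)]
    linarith
  have h := one_add_mul_self_le_rpow_one_add (s := -(1 / (n : ℝ))) (p := n / 2)
    (by linarith) (by linarith)
  have e : 1 + (n : ℝ) / 2 * -(1 / (n : ℝ)) = 1 / 2 := by
    field_simp
    norm_num
  rw [e, ← sub_eq_add_neg] at h
  calc (1 / 4 : ℝ) = (1 / 2) ^ 2 := by norm_num
    _ ≤ ((1 - 1 / (n : ℝ)) ^ ((n : ℝ) / 2)) ^ 2 := by gcongr
    _ = (1 - 1 / (n : ℝ)) ^ n := by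
      rw [← Real.rpow_natCast, ← Real.rpow_mul h0, ← Real.rpow_natCast]
      congr 1
      push_cast
      ring

/-- By monotonicity in the number of trials the worst case is `n = k + 1`, where the complement is
the single event that all trials succeed. -/
theorem binomialCdf_mean_le {n k : ℕ} (hk : 0 < k) (hkn : k < n) :
    (binomialCdf n k).eval ((k : ℝ) / n) ≤ 3 / 4 := by
  induction n, hkn using Nat.le_induction with
  | base =>
    have hs : binomialCdf (k + 1) k + bernsteinPolynomial ℝ (k + 1) (k + 1) = 1 := by
      rw [← bernsteinPolynomial.sum ℝ (k + 1)]
      exact (Finset.sum_range_succ _ _).symm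
    rw [eq_sub_of_add_eq hs]
    have h := quarter_le_one_sub_inv_pow (n := k + 1) (by omega)
    have e : (1 : ℝ) - 1 / ((k + 1 : ℕ) : ℝ) = (k : ℝ) / ((k + 1 : ℕ) : ℝ) := by
      push_cast
      field_simp
      ring
    rw [e] at h
    simp only [bernsteinPolynomial, Nat.succ_eq_add_one, Nat.choose_self, Nat.cast_one, one_mul,
      Nat.sub_self, pow_zero, mul_one, eval_sub, eval_one, eval_pow, eval_X]
    linarith
  | succ n hkn ih =>
    push_cast
    exact (binomialCdf_mean_succ_le hk (by omega)).trans ih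

end BinomialTail

/-! ### From binomial tails to counts in i.i.d. samples. -/

section BinomialCount

variable {Z : Type*} [MeasurableSpace Z]

open scoped Classical in
theorem pi_real_setOf_filter_eq (μ : Measure Z) [IsProbabilityMeasure μ] {W : Set Z}
    (hW : MeasurableSet W) {N : ℕ} (E : Finset (Fin N)) :
    (Measure.pi fun _ : Fin N => μ).real {S | Finset.univ.filter (fun i => S i ∈ W) = E} =
      μ.real W ^ E.card * (1 - μ.real W) ^ (N - E.card) := by
  have h : {S : Fin N → Z | Finset.univ.filter (fun i => S i ∈ W) = E} =
      Set.univ.pi fun i => if i ∈ E then W else Wᶜ := by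
    ext S
    simp only [Set.mem_ofPred_eq, Finset.ext_iff, Finset.mem_filter, Finset.mem_univ, true_and,
      Set.mem_pi, Set.mem_univ, forall_const]
    refine forall_congr' fun i => ?_
    by_cases hi : i ∈ E <;> simp [hi]
  rw [h, measureReal_def, Measure.pi_pi, ENNReal.toReal_prod]
  have h2 : ∀ i, (μ (if i ∈ E then W else Wᶜ)).toReal =
      if i ∈ E then μ.real W else 1 - μ.real W := by
    intro i
    split_ifs
    · rfl
    · exact probReal_compl_eq_one_sub hW
  simp_rw [h2]
  rw [Finset.prod_ite]
  simp [Finset.filter_notMem_eq_sdiff, Finset.card_sdiff]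

open scoped Classical in
/-- A binomial random variable with success probability greater than `1 / N` is at least its mean
with probability greater than `1 / 4`. -/
theorem quarter_lt_pi_real_mean_le (μ : Measure Z) [IsProbabilityMeasure μ] {W : Set Z}
    (hW : MeasurableSet W) {N : ℕ} (hq : 1 < N * μ.real W) :
    1 / 4 < (Measure.pi fun _ : Fin N => μ).real
      {S | N * μ.real W ≤ (Finset.univ.filter fun i => S i ∈ W).card} := by
  set q := μ.real W with hqdef
  set P := Measure.pi fun _ : Fin N => μ
  have hq1 : q ≤ 1 := measureReal_le_one
  have hN : (1 : ℝ) < N := by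
    have : (N : ℝ) * q ≤ N := mul_le_of_le_one_right (by positivity) hq1
    linarith
  have hq0 : 0 < q := by
    by_contra h
    nlinarith
  -- Falling short of the mean means a count of at most `k`, and `k / N < q`. Lowering the success
  -- probability to `k / N` strictly increases that tail, up to at most `3 / 4`. The hypothesis `1 <
  -- N q` is what makes `k` positive.
  obtain ⟨k, hk⟩ : ∃ k, ⌈(N : ℝ) * q⌉₊ = k + 1 :=
    Nat.exists_eq_succ_of_ne_zero (Nat.ceil_pos.2 (by linarith)).ne'
  have hk1 : (N : ℝ) * q ≤ k + 1 := by
    have := Nat.le_ceil ((N : ℝ) * q)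
    rw [hk] at this
    exact_mod_cast this
  have hk2 : (k : ℝ) < N * q := Nat.lt_ceil.1 (by omega)
  have hkpos : 0 < k := by
    have : 1 < ⌈(N : ℝ) * q⌉₊ := Nat.lt_ceil.2 (by exact_mod_cast hq)
    omega
  have hkN : k < N := by
    have : (k : ℝ) < N := hk2.trans_le (mul_le_of_le_one_right (by positivity) hq1)
    exact_mod_cast this
  have hmeas : ∀ E : Finset (Fin N),
      MeasurableSet {S : Fin N → Z | Finset.univ.filter (fun i => S i ∈ W) = E} := by
    intro E
    have h : {S : Fin N → Z | Finset.univ.filter (fun i => S i ∈ W) = E} =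
        ⋂ i, {S : Fin N → Z | S i ∈ W ↔ i ∈ E} := by
      ext S
      simp [Finset.ext_iff]
    rw [h]
    refine MeasurableSet.iInter fun i => ?_
    have hm := measurable_pi_apply (X := fun _ : Fin N => Z) i hW
    by_cases hi : i ∈ E
    · simp only [hi, iff_true]
      exact hm
    · simp only [hi, iff_false]
      exact hm.compl
  have hcdf : P.real {S | (Finset.univ.filter fun i => S i ∈ W).card ≤ k} =
      (binomialCdf N k).eval q := by
    have hU : {S : Fin N → Z | (Finset.univ.filter fun i => S i ∈ W).card ≤ k} =
        ⋃ E ∈ (Finset.univ.filter fun E : Finset (Fin N) => E.card ≤ k),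
          {S | Finset.univ.filter (fun i => S i ∈ W) = E} := by
      ext S
      simp
    rw [hU, measureReal_biUnion_finset]
    · simp_rw [P, pi_real_setOf_filter_eq μ hW, ← hqdef]
      rw [← Finset.sum_fiberwise_of_maps_to (t := Finset.range (k + 1)) (g := Finset.card)
        (by simp), binomialCdf, Polynomial.eval_finsetSum]
      refine Finset.sum_congr rfl fun j hj => ?_
      have hs : ((Finset.univ.filter fun E : Finset (Fin N) => E.card ≤ k).filter
          fun E => E.card = j) = Finset.univ.powersetCard j := by
        ext E
        have := Finset.mem_range.1 hj
        simp [Finset.mem_powersetCard]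
        omega
      rw [hs, Finset.sum_congr rfl (g := fun _ => q ^ j * (1 - q) ^ (N - j))
        (fun E hE => by rw [(Finset.mem_powersetCard.1 hE).2])]
      simp [bernsteinPolynomial, mul_assoc]
    · intro E _ F _ hne
      refine Set.disjoint_left.2 fun S h1 h2 => hne ?_
      exact h1.symm.trans h2
    · exact fun E _ => hmeas E
  have hlt : (binomialCdf N k).eval q < 3 / 4 := by
    have hkq : (k : ℝ) / N < q := (div_lt_iff₀ (by linarith)).2 (by linarith)
    exact (binomialCdf_strictAntiOn hkN ⟨by positivity, hkq.le.trans hq1⟩ ⟨hq0.le, hq1⟩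
      hkq).trans_le (binomialCdf_mean_le hkpos hkN)
  have hle : (1 : ℝ) ≤ P.real {S | (Finset.univ.filter fun i => S i ∈ W).card ≤ k} +
      P.real {S | N * q ≤ (Finset.univ.filter fun i => S i ∈ W).card} := by
    refine le_trans ?_ (measureReal_union_le _ _)
    rw [show (1 : ℝ) = P.real Set.univ by simp]
    refine measureReal_mono fun S _ => ?_
    rcases le_or_gt (Finset.univ.filter fun i => S i ∈ W).card k with h | h
    · exact Or.inl h
    · refine Or.inr (hk1.trans ?_)
      exact_mod_cast h
  linarith

end BinomialCount


/-! ### Hypergeometric tails by counting subsets. -/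

section Counting

variable {α : Type*} [Fintype α] [DecidableEq α]

theorem card_filter_card_inter_eq (E : Finset α) (j m : ℕ) (hj : j ≤ m) :
    ((Finset.univ.powersetCard m).filter fun B : Finset α => (B ∩ E).card = j).card =
      E.card.choose j * (Fintype.card α - E.card).choose (m - j) := by
  rw [← Finset.card_compl, ← Finset.card_powersetCard, ← Finset.card_powersetCard,
    ← Finset.card_product]
  refine Finset.card_bij' (fun B _ => (B ∩ E, B \ E)) (fun p _ => p.1 ∪ p.2) ?_ ?_ ?_ ?_
  · intro B hB
    simp only [Finset.mem_filter, Finset.mem_powersetCard_univ] at hB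
    have := Finset.card_inter_add_card_sdiff B E
    simp only [Finset.mem_product, Finset.mem_powersetCard, Finset.inter_subset_right, true_and]
    refine ⟨hB.2, fun x hx => ?_, by omega⟩
    simpa using (Finset.mem_sdiff.1 hx).2
  · rintro ⟨A, C⟩ h
    simp only [Finset.mem_product, Finset.mem_powersetCard] at h
    obtain ⟨⟨hA, hAc⟩, hC, hCc⟩ := h
    have hd : Disjoint C E := by
      rw [← Finset.subset_compl_iff_disjoint_right]
      exact hC
    have hi : (A ∪ C) ∩ E = A := by
      rw [Finset.union_inter_distrib_right, Finset.disjoint_iff_inter_eq_empty.1 hd,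
        Finset.inter_eq_left.2 hA, Finset.union_empty]
    simp only [Finset.mem_filter, Finset.mem_powersetCard_univ, hi, hAc, and_true]
    rw [Finset.card_union_of_disjoint (hd.symm.mono_left hA), hAc, hCc]
    omega
  · intro B _
    rw [Finset.union_comm]
    exact Finset.sdiff_union_inter B E
  · rintro ⟨A, C⟩ h
    simp only [Finset.mem_product, Finset.mem_powersetCard] at h
    obtain ⟨⟨hA, -⟩, hC, -⟩ := h
    have hd : Disjoint C E := by
      rw [← Finset.subset_compl_iff_disjoint_right]
      exact hC
    ext x
    · have : x ∈ A → x ∈ E := fun h => hA h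
      have : x ∈ C → x ∉ E := fun h => Finset.disjoint_left.1 hd h
      simp only [Finset.mem_inter, Finset.mem_union]
      tauto
    · have : x ∈ A → x ∈ E := fun h => hA h
      have : x ∈ C → x ∉ E := fun h => Finset.disjoint_left.1 hd h
      simp only [Finset.mem_sdiff, Finset.mem_union]
      tauto

/-- The hypergeometric tail as a proportion of the subsets of size `m`. -/
theorem Hyp_mul_choose (E : Finset α) {k m : ℕ} (hk : k ≤ m) (hm : m ≤ Fintype.card α) :
    Hyp k m E.card (Fintype.card α) * (Fintype.card α).choose m =
      (((Finset.univ.powersetCard m).filter fun B : Finset α => (B ∩ E).card ≤ k).card : ℝ) := by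
  have hpos : ((Fintype.card α).choose m : ℝ) ≠ 0 := by exact_mod_cast (Nat.choose_pos hm).ne'
  rw [Finset.card_eq_sum_card_fiberwise (t := Finset.range (k + 1))
    (f := fun B : Finset α => (B ∩ E).card)
    (fun B hB => by simpa [Nat.lt_succ_iff] using (Finset.mem_filter.1 hB).2)]
  rw [Hyp, Finset.sum_mul]
  push_cast
  refine Finset.sum_congr rfl fun j hj => ?_
  have hjk : j ≤ k := Nat.lt_succ_iff.1 (Finset.mem_range.1 hj)
  rw [hyp, if_pos (hjk.trans hk), div_mul_cancel₀ _ hpos, Finset.filter_filter,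
    ← Nat.cast_mul, ← card_filter_card_inter_eq E j m (hjk.trans hk)]
  congr 2
  ext B
  simp only [Finset.mem_filter]
  constructor
  · rintro ⟨h1, h2⟩
    exact ⟨h1, by omega, h2⟩
  · rintro ⟨h1, h2, h3⟩
    exact ⟨h1, h3⟩

/-- Realise the success sets as nested sets `E ⊆ E'`: every `B` meeting `E'` in at most `k` points
also meets `E` in at most `k`. -/
theorem Hyp_anti {k m K K' M : ℕ} (hk : k ≤ m) (hm : m ≤ M) (hK : K ≤ K') (hK' : K' ≤ M) :
    Hyp k m K' M ≤ Hyp k m K M := by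
  obtain ⟨E', hE', hEc'⟩ := Finset.exists_subset_card_eq
    (show K' ≤ (Finset.univ : Finset (Fin M)).card by simpa using hK')
  obtain ⟨E, hE, hEc⟩ := Finset.exists_subset_card_eq (s := E') (show K ≤ E'.card by omega)
  have hpos : (0 : ℝ) < M.choose m := by exact_mod_cast Nat.choose_pos hm
  have h1 := Hyp_mul_choose E hk (by simpa using hm)
  have h2 := Hyp_mul_choose E' hk (by simpa using hm)
  rw [hEc, Fintype.card_fin] at h1
  rw [hEc', Fintype.card_fin] at h2
  refine le_of_mul_le_mul_right ?_ hpos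
  rw [h1, h2]
  norm_cast
  refine Finset.card_le_card fun B hB => ?_
  simp only [Finset.mem_filter] at hB ⊢
  exact ⟨hB.1, (Finset.card_le_card (Finset.inter_subset_inter_left hE)).trans hB.2⟩

/-- Few subsets `B` of size `m` have so many elements in `E` that `E` is not larger than the lower
pseudo-inverse of the hypergeometric tail predicts. -/
theorem card_filter_card_le_lowerInv_le (E : Finset α) {m : ℕ} (hm : m ≤ Fintype.card α) {η : ℝ}
    (hη : 0 ≤ η) :
    (((Finset.univ.powersetCard m).filter fun B : Finset α => (B ∩ E).card ≠ 0 ∧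
      E.card ≤ lowerInv ((B ∩ E).card - 1) m (1 - η) (Fintype.card α)).card : ℝ) ≤
      η * (Fintype.card α).choose m := by
  classical
  set F := (Finset.univ.powersetCard m).filter fun B : Finset α => (B ∩ E).card ≠ 0 ∧
      E.card ≤ lowerInv ((B ∩ E).card - 1) m (1 - η) (Fintype.card α) with hF
  rcases F.eq_empty_or_nonempty with h0 | h0
  · rw [h0]
    simp only [Finset.card_empty, Nat.cast_zero]
    positivity
  -- A deviating subset with the smallest intersection, `k + 1`, controls all others: they all meet
  -- `E` in more than `k` points, while `B₀` itself certifies that at least a `1 - η` share of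
  -- subsets meets `E` in at most `k`.
  obtain ⟨B₀, hB₀, hmin⟩ := Finset.exists_min_image F (fun B => (B ∩ E).card) h0
  have hB₀' := hB₀
  simp only [hF, Finset.mem_filter, Finset.mem_powersetCard_univ] at hB₀'
  obtain ⟨hc, hne, hle⟩ := hB₀'
  have hk : (B₀ ∩ E).card ≤ m := hc ▸ Finset.card_le_card Finset.inter_subset_left
  set k := (B₀ ∩ E).card - 1 with hkdef
  have hkm : k ≤ m := by omega
  obtain ⟨⟨hKM, hKp⟩, -⟩ := lowerInv_isGreatest (k := k) (p := 1 - η) hm (by linarith)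
  have hH : 1 - η ≤ Hyp k m E.card (Fintype.card α) := hKp.trans (Hyp_anti hkm hm hle hKM)
  have hcount := Hyp_mul_choose E hkm hm
  have hsub : F ⊆ (Finset.univ.powersetCard m).filter fun B : Finset α => ¬ (B ∩ E).card ≤ k := by
    intro B hB
    have h1 := hmin B hB
    rw [hF, Finset.mem_filter] at hB
    rw [Finset.mem_filter]
    exact ⟨hB.1, by omega⟩
  have htot := Finset.card_filter_add_card_filter_not (s := Finset.univ.powersetCard m)
    (fun B : Finset α => (B ∩ E).card ≤ k)
  rw [Finset.card_powersetCard, Finset.card_univ] at htot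
  have htot' : (((Finset.univ.powersetCard m).filter
      fun B : Finset α => (B ∩ E).card ≤ k).card : ℝ) + (((Finset.univ.powersetCard m).filter
      fun B : Finset α => ¬ (B ∩ E).card ≤ k).card : ℝ) = (Fintype.card α).choose m := by
    exact_mod_cast htot
  have hFc : (F.card : ℝ) ≤ _ := Nat.cast_le.2 (Finset.card_le_card hsub)
  have hC : (0 : ℝ) ≤ (Fintype.card α).choose m := by positivity
  nlinarith [mul_le_mul_of_nonneg_right hH hC]

end Counting


/-! ### Product samples, permutations and sections. -/

section Sampling

theorem measurePreserving_fin_append {Z : Type*} [MeasurableSpace Z] (μ : Measure Z)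
    [SigmaFinite μ] (m m' : ℕ) :
    MeasurePreserving (fun p : (Fin m → Z) × (Fin m' → Z) => Fin.append p.1 p.2)
      ((Measure.pi fun _ => μ).prod (Measure.pi fun _ => μ)) (Measure.pi fun _ => μ) := by
  have hmeas : Measurable fun p : (Fin m → Z) × (Fin m' → Z) => Fin.append p.1 p.2 := by
    refine measurable_pi_iff.2 fun i => ?_
    refine Fin.addCases (fun i => ?_) (fun i => ?_) i
    · simp only [Fin.append_left]
      exact (measurable_pi_apply i).comp measurable_fst
    · simp only [Fin.append_right]
      exact (measurable_pi_apply i).comp measurable_snd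
  refine ⟨hmeas, (Measure.pi_eq fun s hs => ?_).symm⟩
  rw [Measure.map_apply hmeas (MeasurableSet.univ_pi hs)]
  have h : (fun p : (Fin m → Z) × (Fin m' → Z) => Fin.append p.1 p.2) ⁻¹' Set.univ.pi s =
      (Set.univ.pi fun i => s (Fin.castAdd m' i)) ×ˢ
        (Set.univ.pi fun i => s (Fin.natAdd m i)) := by
    ext p
    simp only [Set.mem_preimage, Set.mem_pi, Set.mem_univ, forall_const, Set.mem_prod]
    constructor
    · intro h
      exact ⟨fun i => by simpa using h (Fin.castAdd m' i),
        fun i => by simpa using h (Fin.natAdd m i)⟩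
    · rintro ⟨h1, h2⟩ i
      refine Fin.addCases (fun i => ?_) (fun i => ?_) i
      · simpa using h1 i
      · simpa using h2 i
  rw [h, Measure.prod_prod, Measure.pi_pi, Measure.pi_pi, Fin.prod_univ_add]

theorem measurePreserving_comp_perm {Z ι : Type*} [Fintype ι] [MeasurableSpace Z] (μ : Measure Z)
    [SigmaFinite μ] (σ : Equiv.Perm ι) :
    MeasurePreserving (fun T : ι → Z => T ∘ σ)
      (Measure.pi fun _ => μ) (Measure.pi fun _ => μ) := by
  have hmeas : Measurable fun T : ι → Z => T ∘ σ :=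
    measurable_pi_iff.2 fun i => measurable_pi_apply (σ i)
  refine ⟨hmeas, (Measure.pi_eq fun s hs => ?_).symm⟩
  rw [Measure.map_apply hmeas (MeasurableSet.univ_pi hs)]
  have h : (fun T : ι → Z => T ∘ σ) ⁻¹' Set.univ.pi s =
      Set.univ.pi fun i => s (σ.symm i) := by
    ext T
    simp only [Set.mem_preimage, Set.mem_pi, Set.mem_univ, forall_const, Function.comp_apply]
    exact ⟨fun h i => by simpa using h (σ.symm i), fun h i => by simpa using h (σ i)⟩
  rw [h, Measure.pi_pi, Equiv.prod_comp σ.symm fun i => μ (s i)]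

/-- If all sections of `A` over `B` are large, then `B` is small compared to `A`. Neither set needs
to be measurable. -/
theorem measureReal_lt_of_lt_section {α β : Type*} [MeasurableSpace α] [MeasurableSpace β]
    (μ : Measure α) (ν : Measure β) [IsProbabilityMeasure μ] [IsProbabilityMeasure ν]
    {A : Set (α × β)} {B : Set α} {c δ : ℝ} (hc : 0 < c) (hδ : 0 < δ)
    (hA : (μ.prod ν).real A ≤ c * δ) (hB : ∀ a ∈ B, c < ν.real (Prod.mk a ⁻¹' A)) :
    μ.real B < δ := by
  -- A measurable hull has the same measure as `A` and larger sections, so Markov's inequality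
  -- applies to a measurable set `C` containing `B`.
  set A' := toMeasurable (μ.prod ν) A with hA'
  have hmA' : MeasurableSet A' := measurableSet_toMeasurable _ _
  have hAA' : A ⊆ A' := subset_toMeasurable _ _
  have hf : Measurable fun a => ν (Prod.mk a ⁻¹' A') := measurable_measure_prodMk_left hmA'
  set C := {a | ENNReal.ofReal c < ν (Prod.mk a ⁻¹' A')} with hC
  have hmC : MeasurableSet C := measurableSet_lt measurable_const hf
  have hBC : B ⊆ C := by
    intro a ha
    have h1 := (hB a ha).trans_le (measureReal_mono (μ := ν) (Set.preimage_mono hAA'))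
    exact (ENNReal.ofReal_lt_iff_lt_toReal hc.le (measure_ne_top _ _)).2 h1
  refine (measureReal_mono hBC).trans_lt ?_
  by_cases h0 : μ C = 0
  · simpa [measureReal_def, h0] using hδ
  have hlt : ENNReal.ofReal c * μ C < (μ.prod ν) A := by
    calc ENNReal.ofReal c * μ C = ∫⁻ _ in C, ENNReal.ofReal c ∂μ := by rw [setLIntegral_const]
      _ < ∫⁻ a in C, ν (Prod.mk a ⁻¹' A') ∂μ := by
        refine setLIntegral_strict_mono hmC h0 hf ?_ (Filter.Eventually.of_forall fun a ha => ha)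
        rw [setLIntegral_const]
        exact ENNReal.mul_ne_top ENNReal.ofReal_ne_top (measure_ne_top _ _)
      _ ≤ ∫⁻ a, ν (Prod.mk a ⁻¹' A') ∂μ := setLIntegral_le_lintegral _ _
      _ = (μ.prod ν) A := by rw [← Measure.prod_apply hmA', hA', measure_toMeasurable]
  have h2 := ENNReal.toReal_strict_mono (measure_ne_top _ _) hlt
  rw [ENNReal.toReal_mul, ENNReal.toReal_ofReal hc.le] at h2
  exact lt_of_mul_lt_mul_left (h2.trans_le hA) hc.le

end Sampling

/-! ### The deviation event: exchangeability, union bound and ghost sample. -/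

section Deviation

variable {X : Type*} {n : ℕ}

/-- The positions at which the labels `c` differ from those of the sample `T`. -/
def errorSet {N : ℕ} (c : Fin N → Fin n) (T : Fin N → X × Fin n) : Finset (Fin N) :=
  Finset.univ.filter fun i => c i ≠ (T i).2

/-- The samples on which some classifier makes surprisingly few errors outside `B`, given its
number of errors in `B`. -/
def deviationSet (H : Set (X → Fin n)) {N : ℕ} (m : ℕ) (η : ℝ) (B : Finset (Fin N)) :
    Set (Fin N → X × Fin n) :=
  {T | ∃ c ∈ traces H fun i => (T i).1, (B ∩ errorSet c T).card ≠ 0 ∧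
    (errorSet c T).card ≤ lowerInv ((B ∩ errorSet c T).card - 1) m (1 - η) N}

theorem mem_traces_comp_perm {H : Set (X → Fin n)} {N : ℕ} {x : Fin N → X} {c : Fin N → Fin n}
    (hc : c ∈ traces H x) (σ : Equiv.Perm (Fin N)) : c ∘ σ ∈ traces H (x ∘ σ) := by
  obtain ⟨h, hh, hx⟩ := hc
  exact ⟨h, hh, fun i => hx (σ i)⟩

theorem comp_perm_mem_deviationSet {H : Set (X → Fin n)} {N m : ℕ} {η : ℝ} {B : Finset (Fin N)}
    {T : Fin N → X × Fin n} (σ : Equiv.Perm (Fin N))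
    (hT : T ∈ deviationSet H m η (B.map σ.toEmbedding)) : T ∘ σ ∈ deviationSet H m η B := by
  obtain ⟨c, hc, h⟩ := hT
  refine ⟨c ∘ σ, mem_traces_comp_perm hc σ, ?_⟩
  have h1 : errorSet c T = (errorSet (c ∘ σ) (T ∘ σ)).map σ.toEmbedding := by
    ext i
    simp only [errorSet, Finset.mem_map_equiv, Finset.mem_filter, Finset.mem_univ, true_and,
      Function.comp_apply, Equiv.apply_symm_apply]
  rw [h1, ← Finset.map_inter, Finset.card_map, Finset.card_map] at h
  exact h

theorem preimage_comp_perm_deviationSet (H : Set (X → Fin n)) {N : ℕ} (m : ℕ) (η : ℝ)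
    (B : Finset (Fin N)) (σ : Equiv.Perm (Fin N)) :
    (fun T : Fin N → X × Fin n => T ∘ σ) ⁻¹' deviationSet H m η B =
      deviationSet H m η (B.map σ.toEmbedding) := by
  ext T
  refine ⟨fun h => ?_, fun h => comp_perm_mem_deviationSet σ h⟩
  have hB : B = (B.map σ.toEmbedding).map σ.symm.toEmbedding := by
    ext i
    simp
  rw [Set.mem_preimage, hB] at h
  have h2 := comp_perm_mem_deviationSet σ.symm h
  rwa [Function.comp_assoc, Equiv.self_comp_symm, Function.comp_id] at h2

theorem exists_perm_map_eq {N : ℕ} {B B' : Finset (Fin N)} (h : B.card = B'.card) :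
    ∃ σ : Equiv.Perm (Fin N), B.map σ.toEmbedding = B' := by
  let e : {x // x ∈ B} ≃ {x // x ∈ B'} := Finset.equivOfCardEq h
  refine ⟨e.extendSubtype, Finset.eq_of_subset_of_card_le ?_ (by simp [h])⟩
  intro x hx
  obtain ⟨y, hy, rfl⟩ := Finset.mem_map.1 hx
  exact e.extendSubtype_mem y hy

theorem ncard_traces_le_growth (H : Set (X → Fin n)) {N : ℕ} (x : Fin N → X) :
    (traces H x).ncard ≤ growth H N :=
  le_ciSup (growth_bddAbove H N) x

-- The union bound is taken with `T` fixed, so the number of label vectors is at most the growth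
-- function although `H` may be infinite.
open scoped Classical in
theorem card_filter_mem_deviationSet_le (H : Set (X → Fin n)) {N m : ℕ} (hm : m ≤ N) {η : ℝ}
    (hη : 0 ≤ η) (T : Fin N → X × Fin n) :
    (((Finset.univ.powersetCard m).filter fun B => T ∈ deviationSet H m η B).card : ℝ) ≤
      growth H N * η * N.choose m := by
  set t : Finset (Fin N → Fin n) := (Set.toFinite (traces H fun i => (T i).1)).toFinset
  have hsub : ((Finset.univ.powersetCard m).filter fun B => T ∈ deviationSet H m η B) ⊆
      t.biUnion fun c => (Finset.univ.powersetCard m).filter fun B : Finset (Fin N) =>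
        (B ∩ errorSet c T).card ≠ 0 ∧
          (errorSet c T).card ≤ lowerInv ((B ∩ errorSet c T).card - 1) m (1 - η) N := by
    intro B hB
    obtain ⟨hB, c, hc, h⟩ := Finset.mem_filter.1 hB
    exact Finset.mem_biUnion.2 ⟨c, by simpa [t] using hc, Finset.mem_filter.2 ⟨hB, h⟩⟩
  have ht : (t.card : ℝ) ≤ growth H N := by
    rw [← Set.ncard_eq_toFinset_card]
    exact_mod_cast ncard_traces_le_growth H _
  calc (((Finset.univ.powersetCard m).filter fun B => T ∈ deviationSet H m η B).card : ℝ)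
      ≤ ∑ c ∈ t, (((Finset.univ.powersetCard m).filter fun B : Finset (Fin N) =>
        (B ∩ errorSet c T).card ≠ 0 ∧
          (errorSet c T).card ≤ lowerInv ((B ∩ errorSet c T).card - 1) m (1 - η) N).card : ℝ) := by
        exact_mod_cast (Finset.card_le_card hsub).trans Finset.card_biUnion_le
    _ ≤ ∑ _c ∈ t, η * N.choose m := by
        refine Finset.sum_le_sum fun c _ => ?_
        have := card_filter_card_le_lowerInv_le (errorSet c T) (m := m) (by simpa using hm) hη
        rw [Fintype.card_fin] at this
        convert this
    _ = t.card * (η * N.choose m) := by rw [Finset.sum_const, nsmul_eq_mul]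
    _ ≤ growth H N * (η * N.choose m) := by gcongr
    _ = _ := by ring

variable [MeasurableSpace X]

/-- There are finitely many label vectors `c`; for each, the remaining condition depends only on the
observed labels, which range over a finite set. -/
theorem nullMeasurableSet_deviationSet {D : Measure (X × Fin n)} {H : Set (X → Fin n)} {N : ℕ}
    (hH : IsMeasurableClass D H N) (m : ℕ) (η : ℝ) (B : Finset (Fin N)) :
    NullMeasurableSet (deviationSet H m η B) (Measure.pi fun _ : Fin N => D) := by
  have h : deviationSet H m η B = ⋃ c : Fin N → Fin n,
      {T : Fin N → X × Fin n | c ∈ traces H fun i => (T i).1} ∩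
        (fun T : Fin N → X × Fin n => fun i => (T i).2) ⁻¹'
          {y | (B ∩ Finset.univ.filter fun i => c i ≠ y i).card ≠ 0 ∧
            (Finset.univ.filter fun i => c i ≠ y i).card ≤
              lowerInv ((B ∩ Finset.univ.filter fun i => c i ≠ y i).card - 1) m (1 - η) N} := by
    ext T
    simp [deviationSet, errorSet]
  rw [h]
  refine NullMeasurableSet.iUnion fun c => (hH.nullMeasurableSet_traces c).inter ?_
  refine MeasurableSet.nullMeasurableSet ?_
  have hy : Measurable fun T : Fin N → X × Fin n => fun i => (T i).2 :=
    measurable_pi_iff.2 fun i => measurable_snd.comp (measurable_pi_apply i)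
  exact hy (Set.toFinite _).measurableSet

/-- By exchangeability, the deviation event of a fixed set of positions is at most as likely as it
is, for the worst sample, for random positions. -/
theorem measureReal_deviationSet_le {D : Measure (X × Fin n)} [IsProbabilityMeasure D]
    {H : Set (X → Fin n)} {N m : ℕ} (hm : m ≤ N) (hH : IsMeasurableClass D H N) {η : ℝ}
    (hη : 0 ≤ η) {B : Finset (Fin N)} (hB : B.card = m) :
    (Measure.pi fun _ : Fin N => D).real (deviationSet H m η B) ≤ growth H N * η := by
  classical
  set P := Measure.pi fun _ : Fin N => D
  have hnull := fun B => nullMeasurableSet_deviationSet hH m η B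
  have hinv : ∀ B' ∈ Finset.univ.powersetCard m,
      P (deviationSet H m η B') = P (deviationSet H m η B) := by
    intro B' hB'
    obtain ⟨σ, rfl⟩ := exists_perm_map_eq (hB.trans (Finset.mem_powersetCard.1 hB').2.symm)
    rw [← preimage_comp_perm_deviationSet]
    exact (measurePreserving_comp_perm D σ).measure_preimage (hnull B)
  -- All `m`-subsets have equally likely deviation events, so the left side is the expected number
  -- of deviating subsets, which is bounded sample by sample.
  have hsum : (N.choose m : ENNReal) * P (deviationSet H m η B) ≤
      ENNReal.ofReal (growth H N * η * N.choose m) := by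
    calc (N.choose m : ENNReal) * P (deviationSet H m η B)
        = ∑ B' ∈ Finset.univ.powersetCard m, P (deviationSet H m η B') := by
          rw [Finset.sum_congr rfl hinv, Finset.sum_const, Finset.card_powersetCard,
            Finset.card_univ, Fintype.card_fin, nsmul_eq_mul]
      _ = ∫⁻ T, ∑ B' ∈ Finset.univ.powersetCard m,
            (deviationSet H m η B').indicator 1 T ∂P := by
          have hae : ∀ B' ∈ Finset.univ.powersetCard m, AEMeasurable
              ((deviationSet H m η B').indicator (1 : (Fin N → X × Fin n) → ENNReal)) P :=
            fun B' _ => aemeasurable_one.indicator₀ (hnull B')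
          rw [lintegral_finsetSum' _ hae]
          exact Finset.sum_congr rfl fun B' _ => (lintegral_indicator_one₀ (hnull B')).symm
      _ ≤ ∫⁻ _, ENNReal.ofReal (growth H N * η * N.choose m) ∂P := by
          refine lintegral_mono fun T => ?_
          have := card_filter_mem_deviationSet_le H hm hη T
          have hs : ∑ B' ∈ Finset.univ.powersetCard m, (deviationSet H m η B').indicator
              (1 : (Fin N → X × Fin n) → ENNReal) T =
              ((Finset.univ.powersetCard m).filter fun B => T ∈ deviationSet H m η B).card := by
            simp only [Set.indicator_apply, Pi.one_apply, Finset.card_filter]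
            push_cast
            rfl
          rw [hs, ← ENNReal.ofReal_natCast]
          exact ENNReal.ofReal_le_ofReal this
      _ = _ := by simp
  have hpos : (0 : ℝ) < N.choose m := by exact_mod_cast Nat.choose_pos hm
  have h := ENNReal.toReal_mono ENNReal.ofReal_ne_top hsum
  rw [ENNReal.toReal_ofReal (by positivity), ENNReal.toReal_mul, ENNReal.toReal_natCast,
    mul_comm] at h
  exact le_of_mul_le_mul_right h hpos

theorem trueRisk_eq_one_sub (D : Measure (X × Fin n)) [IsProbabilityMeasure D] {h : X → Fin n}
    (hW : MeasurableSet {z : X × Fin n | h z.1 = z.2}) :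
    trueRisk D h = 1 - D.real {z | h z.1 = z.2} := by
  rw [← probReal_compl_eq_one_sub hW, ← integral_indicator_one hW.compl, trueRisk]
  refine integral_congr_ae (Filter.Eventually.of_forall fun z => ?_)
  simp [Set.indicator_apply]

/-- If a classifier violates the bound on `S`, then with probability greater than `1 / 4` a second
sample exhibits a deviation. -/
theorem quarter_lt_append_mem_deviationSet {D : Measure (X × Fin n)} [IsProbabilityMeasure D]
    {H : Set (X → Fin n)} {m m' : ℕ} (hm' : 0 < m') {δ : ℝ} {h : X → Fin n} (hh : h ∈ H)
    (hmeas : Measurable h) {S : Fin m → X × Fin n}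
    (hS : trueRisk D h < lowerBound H m m' δ (numErrors S h)) :
    1 / 4 < (Measure.pi fun _ : Fin m' => D).real {S' | Fin.append S S' ∈
      deviationSet H m (δ / (4 * (growth H (m + m') : ℝ)))
        (Finset.univ.map (Fin.castAddEmb m'))} := by
  classical
  set W := {z : X × Fin n | h z.1 = z.2}
  have hW : MeasurableSet W := measurableSet_eq_fun (hmeas.comp measurable_fst) measurable_snd
  have hrisk := trueRisk_eq_one_sub D hW
  have hq1 : D.real W ≤ 1 := measureReal_le_one
  have hk : numErrors S h ≠ 0 := by
    intro h0
    rw [h0, lowerBound, if_pos rfl] at hS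
    linarith
  have hm'pos : (0 : ℝ) < m' := by exact_mod_cast hm'
  rw [lowerBound, if_neg hk, one_div_mul_eq_div, lt_div_iff₀ hm'pos, lt_min_iff] at hS
  obtain ⟨hS1, hS2⟩ := hS
  rw [hrisk] at hS1 hS2
  refine (quarter_lt_pi_real_mean_le D hW (N := m') (by linarith)).trans_le
    (measureReal_mono fun S' hS' => ?_)
  set T := Fin.append S S'
  refine ⟨fun i => h (T i).1, ⟨h, hh, fun i => rfl⟩, ?_⟩
  set E := errorSet (fun i => h (T i).1) T with hE
  have hBE : (Finset.univ.map (Fin.castAddEmb m') ∩ E).card = numErrors S h := by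
    have hne : ∀ (a : Fin m) (b : Fin m'), Fin.castAdd m' a ≠ Fin.natAdd m b := by
      intro a b hab
      have := congrArg Fin.val hab
      simp only [Fin.val_castAdd, Fin.val_natAdd] at this
      omega
    have : Finset.univ.map (Fin.castAddEmb m') ∩ E =
        (Finset.univ.filter fun i => h (S i).1 ≠ (S i).2).map (Fin.castAddEmb m') := by
      ext i
      refine Fin.addCases (fun i => ?_) (fun i => ?_) i <;>
        simp [hE, errorSet, T, hne]
    rw [this, Finset.card_map, numErrors]
  have hEc : E.card + (Finset.univ.filter fun i => S' i ∈ W).card = numErrors S h + m' := by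
    have h1 : E.card = numErrors S h + numErrors S' h := by
      simp only [hE, errorSet, numErrors, Finset.card_filter, Fin.sum_univ_add, T,
        Fin.append_left, Fin.append_right]
    have h2 := Finset.card_filter_add_card_filter_not (s := Finset.univ) (fun i => S' i ∈ W)
    rw [Finset.card_univ, Fintype.card_fin] at h2
    have h3 : numErrors S' h = (Finset.univ.filter fun i => ¬ S' i ∈ W).card := rfl
    omega
  rw [hBE]
  refine ⟨hk, ?_⟩
  have hEc' : (E.card : ℝ) + ((Finset.univ.filter fun i => S' i ∈ W).card : ℝ) =
      numErrors S h + m' := by exact_mod_cast hEc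
  have hS'' : (m' : ℝ) * D.real W ≤ ((Finset.univ.filter fun i => S' i ∈ W).card : ℝ) := by
    rw [Set.mem_ofPred_eq] at hS'
    convert hS'
  -- The number of errors in the joint sample is at most `k + m' (1 - q)`, hence strictly below the
  -- pseudo-inverse plus one; integrality removes the `+ 1`.
  rw [← Nat.lt_succ_iff]
  have : (E.card : ℝ) < (lowerInv (numErrors S h - 1) m
      (1 - δ / (4 * (growth H (m + m') : ℝ))) (m + m') : ℝ) + 1 := by linarith
  exact_mod_cast this

end Deviation

end HypTail

end

theorem theorem3 {X : Type*} [MeasurableSpace X] {n : ℕ}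
    (H : Set (X → Fin n)) (D : Measure (X × Fin n)) [IsProbabilityMeasure D]
    (δ : ℝ) (hδ : δ ∈ Set.Ioo (0 : ℝ) 1) (m m' : ℕ) (hm : 0 < m) (hm' : 0 < m')
    (hH : HypTail.IsMeasurableClass D H (m + m')) :
    -- the probability that the bound holds for all `h ∈ H` simultaneously exceeds `1 - δ`
    1 - δ < (Measure.pi fun _ : Fin m => D).real
        {S | ∀ h ∈ H, HypTail.lowerBound H m m' δ (HypTail.numErrors S h)
          ≤ HypTail.trueRisk D h} ∧
    -- the (outer) probability that it fails for some `h ∈ H` is less than `δ`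
    (Measure.pi fun _ : Fin m => D).real
        {S | ∃ h ∈ H, HypTail.trueRisk D h
          < HypTail.lowerBound H m m' δ (HypTail.numErrors S h)} < δ := by
  have hbad : (Measure.pi fun _ : Fin m => D).real
      {S | ∃ h ∈ H, HypTail.trueRisk D h
        < HypTail.lowerBound H m m' δ (HypTail.numErrors S h)} < δ := by
    set η := δ / (4 * (HypTail.growth H (m + m') : ℝ)) with hη
    set B : Finset (Fin (m + m')) := Finset.univ.map (Fin.castAddEmb m')
    have hη0 : 0 ≤ η := div_nonneg hδ.1.le (by positivity)
    have hA := HypTail.measureReal_deviationSet_le (Nat.le_add_right m m') hH hη0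
      (B := B) (by simp [B])
    have hgη : (HypTail.growth H (m + m') : ℝ) * η ≤ 1 / 4 * δ := by
      -- A zero growth function is treated apart, since the division defining `η` cannot then be
      -- cancelled.
      rcases eq_or_ne (HypTail.growth H (m + m') : ℝ) 0 with h0 | h0
      · rw [h0, zero_mul]
        linarith [hδ.1]
      · rw [hη]
        field_simp
        rfl
    refine HypTail.measureReal_lt_of_lt_section _ (Measure.pi fun _ : Fin m' => D)
      (A := (fun p : (Fin m → X × Fin n) × (Fin m' → X × Fin n) => Fin.append p.1 p.2) ⁻¹'
        HypTail.deviationSet H m η B) (c := 1 / 4) (by norm_num) hδ.1 ?_ ?_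
    · rw [measureReal_def, (HypTail.measurePreserving_fin_append D m m').measure_preimage
        (HypTail.nullMeasurableSet_deviationSet hH m η B)]
      exact hA.trans hgη
    · rintro S ⟨h, hh, hS⟩
      exact HypTail.quarter_lt_append_mem_deviationSet hm' hh (hH.measurable h hh) hS
  refine ⟨?_, hbad⟩
  -- Subadditivity replaces the complement rule because neither event is known to be measurable.
  have hle := measureReal_union_le (μ := Measure.pi fun _ : Fin m => D)
    {S | ∀ h ∈ H, HypTail.lowerBound H m m' δ (HypTail.numErrors S h) ≤ HypTail.trueRisk D h}
    {S | ∃ h ∈ H, HypTail.trueRisk D h < HypTail.lowerBound H m m' δ (HypTail.numErrors S h)}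
  have huniv : ({S | ∀ h ∈ H, HypTail.lowerBound H m m' δ (HypTail.numErrors S h)
      ≤ HypTail.trueRisk D h} ∪ {S | ∃ h ∈ H, HypTail.trueRisk D h
        < HypTail.lowerBound H m m' δ (HypTail.numErrors S h)} : Set (Fin m → X × Fin n)) =
      Set.univ := by
    ext S
    simp only [Set.mem_union, Set.mem_ofPred_eq, Set.mem_univ, iff_true]
    by_contra! hS
    obtain ⟨⟨h, hh, h1⟩, h2⟩ := hS
    exact (h2 h hh).not_gt h1
  rw [huniv, probReal_univ] at hle
  linarith
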